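/- Theorem. Let $N\ge 5$ be an integer and $R\ge 0$, let $\Omega_{R,N}=\{(r\cos\theta,r\sin\theta): r>R,\ -\pi/N<\theta<\pi/N\}\subset\mathbf R^2$, and let $\Omega'\subset\Omega_{R,N}$ be open. Let $dm(\xi)=e^{-|\xi|^2/2}\,d\xi$, let $H(\Omega')=L^2(\Omega',dm)$, let $V(\Omega')$ be the Hilbert space of all real-valued $f\in H(\Omega')$ whose weak partial derivatives $\partial_1 f,\partial_2 f$ exist and belong to $H(\Omega')$, with the inner product $(f,g)_V=\int_{\Omega'}(fg+Df\cdot Dg)\,dm$, and let $V_0(\Omega')$ be the closure of $C_c^\infty(\Omega')$ in $V(\Omega')$. Suppose that $u\in V(\Omega')$ satisfies $\Delta u-\xi\cdot Du+u\ge 0$ weakly in $\Omega'$, that is, $$\int_{\Omega'}\bigl(Du\cdot Dv-uv\bigr)\,dm\le 0\qquad\text{for all } v\in C_c^\infty(\Omega')\text{ with } v\ge 0,$$ and that $u\le 0$ on $\partial\Omega'$ in the sense that $u^+=\max(u,0)\in V_0(\Omega')$. Then $u\le 0$ almost everywhere in $\Omega'$. -/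

import Mathlib

open MeasureTheory TopologicalSpace
open scoped Gradient Distributions

namespace GaussianSobolev

/-- The (unnormalised) Gaussian measure `dm(ξ) = exp (-|ξ|² / 2) dξ` on `ℝⁿ`. -/
noncomputable def gaussian (n : ℕ) : Measure (EuclideanSpace ℝ (Fin n)) :=
  volume.withDensity fun ξ => ENNReal.ofReal (Real.exp (-(1 / 2) * ‖ξ‖ ^ 2))

/-- `Du` is the weak (distributional) gradient of `u` in the open set `Ω ⊆ ℝⁿ`: both are locally
integrable in `Ω` and `∫ u ∂ᵢφ dξ = - ∫ (Du)ᵢ φ dξ` for all `i` and all `φ ∈ C_c^∞(Ω)`. -/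
structure IsWeakGradient {n : ℕ} (Ω : Opens (EuclideanSpace ℝ (Fin n)))
    (u : EuclideanSpace ℝ (Fin n) → ℝ)
    (Du : EuclideanSpace ℝ (Fin n) → EuclideanSpace ℝ (Fin n)) : Prop where
  locallyIntegrableOn_fun : LocallyIntegrableOn u (Ω : Set (EuclideanSpace ℝ (Fin n)))
  locallyIntegrableOn_grad : LocallyIntegrableOn Du (Ω : Set (EuclideanSpace ℝ (Fin n)))
  integral_eq : ∀ (i : Fin n) (φ : 𝓓(Ω, ℝ)),
    ∫ ξ in (Ω : Set (EuclideanSpace ℝ (Fin n))), u ξ * (∇ φ ξ) i =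
      -∫ ξ in (Ω : Set (EuclideanSpace ℝ (Fin n))), (Du ξ) i * φ ξ

/-- `u ∈ H = L²(Ω, dm)`. -/
def MemH {n : ℕ} (Ω : Opens (EuclideanSpace ℝ (Fin n))) (u : EuclideanSpace ℝ (Fin n) → ℝ) :
    Prop :=
  MemLp u 2 ((gaussian n).restrict Ω)

/-- `u ∈ V(Ω)`, with weak gradient `Du`: both `u` and `Du` are square integrable for `dm`. -/
structure MemVWith {n : ℕ} (Ω : Opens (EuclideanSpace ℝ (Fin n)))
    (u : EuclideanSpace ℝ (Fin n) → ℝ)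
    (Du : EuclideanSpace ℝ (Fin n) → EuclideanSpace ℝ (Fin n)) : Prop where
  memH : MemH Ω u
  isWeakGradient : IsWeakGradient Ω u Du
  memLp_grad : MemLp Du 2 ((gaussian n).restrict Ω)

/-- `u ∈ V(Ω)`. -/
def MemV {n : ℕ} (Ω : Opens (EuclideanSpace ℝ (Fin n))) (u : EuclideanSpace ℝ (Fin n) → ℝ) :
    Prop :=
  ∃ Du : EuclideanSpace ℝ (Fin n) → EuclideanSpace ℝ (Fin n), MemVWith Ω u Du

/-- `u ∈ V₀(Ω)`, the closure of `C_c^∞(Ω)` in `V(Ω)`: `u ∈ V(Ω)` and there are test functions `φ`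
with `‖u - φ‖_V² = ‖u - φ‖_H² + ‖Du - Dφ‖_H²` arbitrarily small. -/
def MemV₀ {n : ℕ} (Ω : Opens (EuclideanSpace ℝ (Fin n))) (u : EuclideanSpace ℝ (Fin n) → ℝ) :
    Prop :=
  ∃ Du : EuclideanSpace ℝ (Fin n) → EuclideanSpace ℝ (Fin n), MemVWith Ω u Du ∧
    ∀ ε : ENNReal, 0 < ε → ∃ φ : 𝓓(Ω, ℝ),
      eLpNorm (fun ξ => u ξ - φ ξ) 2 ((gaussian n).restrict Ω) ^ 2 +
        eLpNorm (fun ξ => Du ξ - ∇ φ ξ) 2 ((gaussian n).restrict Ω) ^ 2 < ε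

/-- `u ∈ V(Ω)` satisfies `Δu - ξ · Du + u ≥ 0` weakly in `Ω`. The operator is in divergence form
with respect to `dm`, so that this means `∫ (Du · Dφ - u φ) dm ≤ 0` for all `0 ≤ φ ∈ C_c^∞(Ω)`. -/
def IsWeakSubsolution {n : ℕ} (Ω : Opens (EuclideanSpace ℝ (Fin n)))
    (u : EuclideanSpace ℝ (Fin n) → ℝ) : Prop :=
  ∃ Du : EuclideanSpace ℝ (Fin n) → EuclideanSpace ℝ (Fin n), MemVWith Ω u Du ∧
    ∀ φ : 𝓓(Ω, ℝ), (∀ ξ, 0 ≤ φ ξ) →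
      ∫ ξ in (Ω : Set (EuclideanSpace ℝ (Fin n))),
        (inner ℝ (Du ξ) (∇ φ ξ) - u ξ * φ ξ) ∂(gaussian n) ≤ 0

/-- The plane sector `Ω_{R,N} = {(r, θ) : R < r, -π/N < θ < π/N}` in polar coordinates `(r, θ)`
(meant for `R ≥ 0`). -/
def sector (R : ℝ) (N : ℕ) : Set (EuclideanSpace ℝ (Fin 2)) :=
  {ξ | ∃ r θ : ℝ, R < r ∧ -(Real.pi / N) < θ ∧ θ < Real.pi / N ∧
    ξ = !₂[r * Real.cos θ, r * Real.sin θ]}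

end GaussianSobolev

/-!
Inside the sector of half-angle `π / N ≤ π / 5` the two linear forms `(ξ₀ ± ξ₁) / √2` are positive,
so that `Ω'` lies in a rotated quarter plane. Each of them is an eigenfunction of the Gaussian
Laplacian `Δ - ξ · D` with eigenvalue `1`, and a positive eigenfunction yields a Hardy type
inequality for test functions (`integral_sq_le_integral_inner_gradient_sq`). Adding the two
inequalities, which concern orthonormal directions, gives the spectral gap
`2 ∫ φ² dm ≤ ∫ |Dφ|² dm` (`two_mul_integral_sq_le`).

The maximum principle holds as soon as the constant in this inequality exceeds `1`
(`IsWeakSubsolution.ae_nonpos`): formally, testing the differential inequality with `w = u⁺` gives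
`∫ |Dw|² dm ≤ ∫ w² dm`, whence `w = 0`. To justify this without a theory of positive parts in
Sobolev spaces, let `T = √(t² + ε²) - ε`, a smooth nonnegative approximation of `|t|` with
`T(0) = T'(0) = 0` and `|T'| ≤ 1`, and let `φₖ → w` be test functions.
* `T ∘ φₖ` are nonnegative test functions which converge to `T ∘ w` in `V`, with gradients
  converging to `T'(w) Dw` (`TendstoV.compTest`). Hence the differential inequality may be tested
  with `T ∘ w`, and the spectral gap applies to it.
* `Dw = Du` almost everywhere on `{w > 0}`: integrate by parts against `η (T ∘ φₖ)` and use that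
  `(w - u) T(w)` and `(w - u) T'(w)` vanish identically (`smul_grad_ae_eq_smul_grad`).

Therefore `2 ∫ T(w)² ≤ ∫ T'(w)² |Dw|² ≤ ∫ T'(w) Du · Dw ≤ ∫ w T(w)`, and `ε → 0` gives
`2 ∫ w² ≤ ∫ w²`.
-/

open Filter Topology
open scoped ContDiff

namespace GaussianSobolev

/-! ### Convergence in `L²` -/

section L2

variable {α E : Type*} [MeasurableSpace α] {μ : Measure α} [NormedAddCommGroup E]

theorem tendsto_eLpNorm_two_zero_of_dominated {f : ℕ → α → E} {g : α → ℝ}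
    (hf : ∀ k, AEStronglyMeasurable (f k) μ) (hg : MemLp g 2 μ)
    (hle : ∀ k, ∀ᵐ x ∂μ, ‖f k x‖ ≤ g x)
    (hlim : ∀ᵐ x ∂μ, Tendsto (fun k => f k x) atTop (𝓝 0)) :
    Tendsto (fun k => eLpNorm (f k) 2 μ) atTop (𝓝 0) := by
  have key : Tendsto (fun k => ∫⁻ x, ‖f k x‖ₑ ^ (2 : ℝ) ∂μ) atTop (𝓝 (∫⁻ _, 0 ∂μ)) := by
    refine tendsto_lintegral_of_dominated_convergence' (fun x => ‖g x‖ₑ ^ (2 : ℝ))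
      (fun k => (hf k).enorm.pow_const _) (fun k => ?_) ?_ ?_
    · filter_upwards [hle k] with x hx
      gcongr
      exact enorm_le_iff_norm_le.2 (hx.trans (le_abs_self _))
    · simpa using (lintegral_rpow_enorm_lt_top_of_eLpNorm_lt_top (p := 2) (by simp) (by simp)
        hg.2).ne
    · filter_upwards [hlim] with x hx
      simpa using ((continuous_enorm.tendsto _).comp hx).ennrpow_const 2
  simp_rw [eLpNorm_eq_lintegral_rpow_enorm_toReal (μ := μ) (p := 2) two_ne_zero
    ENNReal.ofNat_ne_top]
  simpa using key.ennrpow_const (1 / 2)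

theorem tendsto_integral_inner [InnerProductSpace ℝ E] {f g : ℕ → α → E} {f₀ g₀ : α → E}
    (hf : ∀ k, MemLp (f k) 2 μ) (hg : ∀ k, MemLp (g k) 2 μ) (hf₀ : MemLp f₀ 2 μ)
    (hg₀ : MemLp g₀ 2 μ) (hfl : Tendsto (fun k => eLpNorm (f k - f₀) 2 μ) atTop (𝓝 0))
    (hgl : Tendsto (fun k => eLpNorm (g k - g₀) 2 μ) atTop (𝓝 0)) :
    Tendsto (fun k => ∫ x, inner ℝ (f k x) (g k x) ∂μ) atTop
      (𝓝 (∫ x, inner ℝ (f₀ x) (g₀ x) ∂μ)) := by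
  have aux : ∀ {a b : α → E} (ha : MemLp a 2 μ) (hb : MemLp b 2 μ),
      inner ℝ (ha.toLp a) (hb.toLp b) = ∫ x, inner ℝ (a x) (b x) ∂μ := fun ha hb => by
    rw [L2.inner_def]
    refine integral_congr_ae ?_
    filter_upwards [ha.coeFn_toLp, hb.coeFn_toLp] with x h1 h2
    rw [h1, h2]
  simp_rw [← aux hf₀ hg₀, ← fun k => aux (hf k) (hg k)]
  exact ((Lp.tendsto_Lp_iff_tendsto_eLpNorm'' f hf f₀ hf₀).2 hfl).inner
    ((Lp.tendsto_Lp_iff_tendsto_eLpNorm'' g hg g₀ hg₀).2 hgl)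

theorem tendsto_integral_inner_const [InnerProductSpace ℝ E] {f : α → E} {g : ℕ → α → E}
    {g₀ : α → E} (hf : MemLp f 2 μ) (hg : ∀ k, MemLp (g k) 2 μ) (hg₀ : MemLp g₀ 2 μ)
    (hgl : Tendsto (fun k => eLpNorm (g k - g₀) 2 μ) atTop (𝓝 0)) :
    Tendsto (fun k => ∫ x, inner ℝ (f x) (g k x) ∂μ) atTop
      (𝓝 (∫ x, inner ℝ (f x) (g₀ x) ∂μ)) :=
  tendsto_integral_inner (fun _ => hf) hg hf hg₀ (by simp) hgl

theorem integrable_inner_of_memLp [InnerProductSpace ℝ E] {f g : α → E}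
    (hf : MemLp f 2 μ) (hg : MemLp g 2 μ) : Integrable (fun x => inner ℝ (f x) (g x)) μ := by
  refine (L2.integrable_inner (𝕜 := ℝ) (hf.toLp f) (hg.toLp g)).congr ?_
  filter_upwards [hf.coeFn_toLp, hg.coeFn_toLp] with x h1 h2
  rw [h1, h2]

end L2

/-! ### The Gaussian measure and test functions -/

variable {n : ℕ} {Ω : Opens (EuclideanSpace ℝ (Fin n))}
  {u w : EuclideanSpace ℝ (Fin n) → ℝ}
  {Du Dw : EuclideanSpace ℝ (Fin n) → EuclideanSpace ℝ (Fin n)}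

instance isLocallyFiniteMeasure_gaussian : IsLocallyFiniteMeasure (gaussian n) :=
  IsLocallyFiniteMeasure.withDensity_ofReal (by fun_prop)

theorem setIntegral_gaussian {s : Set (EuclideanSpace ℝ (Fin n))} (hs : MeasurableSet s)
    (f : EuclideanSpace ℝ (Fin n) → ℝ) :
    ∫ ξ in s, f ξ ∂(gaussian n) = ∫ ξ in s, Real.exp (-(1 / 2) * ‖ξ‖ ^ 2) * f ξ := by
  rw [gaussian, restrict_withDensity hs, integral_withDensity_eq_integral_toReal_smul
    (by fun_prop) (by simp)]
  refine integral_congr_ae (ae_of_all _ fun ξ => ?_)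
  simp [ENNReal.toReal_ofReal (Real.exp_pos _).le]

theorem volume_absolutelyContinuous_gaussian : volume ≪ gaussian n :=
  withDensity_absolutelyContinuous' (by fun_prop)
    (ae_of_all _ fun ξ => by simpa using Real.exp_pos _)

theorem hasGradientAt_testFunction (φ : 𝓓(Ω, ℝ)) (ξ : EuclideanSpace ℝ (Fin n)) :
    HasGradientAt φ (∇ φ ξ) ξ :=
  (φ.contDiff.differentiable (by simp)).differentiableAt.hasGradientAt

theorem continuous_gradient_testFunction (φ : 𝓓(Ω, ℝ)) : Continuous (∇ φ) :=
  (InnerProductSpace.toDual ℝ _).symm.continuous.comp (φ.contDiff.continuous_fderiv (by simp))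

theorem hasCompactSupport_gradient_testFunction (φ : 𝓓(Ω, ℝ)) : HasCompactSupport (∇ φ) :=
  (φ.hasCompactSupport.fderiv ℝ).comp_left (map_zero (InnerProductSpace.toDual ℝ _).symm)

theorem memLp_testFunction (φ : 𝓓(Ω, ℝ)) :
    MemLp φ 2 ((gaussian n).restrict Ω) :=
  φ.continuous.memLp_of_hasCompactSupport φ.hasCompactSupport

theorem memLp_gradient_testFunction (φ : 𝓓(Ω, ℝ)) :
    MemLp (∇ φ) 2 ((gaussian n).restrict Ω) :=
  (continuous_gradient_testFunction φ).memLp_of_hasCompactSupport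
    (hasCompactSupport_gradient_testFunction φ)

theorem testFunction_eventuallyEq_zero (φ : 𝓓(Ω, ℝ)) {ξ : EuclideanSpace ℝ (Fin n)}
    (hξ : ξ ∉ Ω) : φ =ᶠ[𝓝 ξ] 0 :=
  notMem_tsupport_iff_eventuallyEq.1 fun h => hξ (φ.tsupport_subset h)

/-- The test function `T ∘ φ`, for smooth `T` with `T 0 = 0`. -/
noncomputable def compTest (T : ℝ → ℝ) (hT : ContDiff ℝ ∞ T) (hT0 : T 0 = 0) (φ : 𝓓(Ω, ℝ)) :
    𝓓(Ω, ℝ) where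
  toFun ξ := T (φ ξ)
  contDiff' := hT.comp φ.contDiff
  hasCompactSupport' := φ.hasCompactSupport.comp_left hT0
  tsupport_subset' := (tsupport_comp_subset hT0 φ).trans φ.tsupport_subset

theorem gradient_compTest (T : ℝ → ℝ) (hT : ContDiff ℝ ∞ T) (hT0 : T 0 = 0) (φ : 𝓓(Ω, ℝ))
    (ξ : EuclideanSpace ℝ (Fin n)) :
    ∇ (compTest T hT hT0 φ) ξ = deriv T (φ ξ) • ∇ φ ξ := by
  have h : HasFDerivAt (compTest T hT hT0 φ) _ ξ :=
    ((hT.differentiable (by simp)) (φ ξ)).hasDerivAt.comp_hasFDerivAt ξ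
      (hasGradientAt_testFunction φ ξ).hasFDerivAt
  rw [h.hasGradientAt.gradient, map_smul, LinearIsometryEquiv.symm_apply_apply]

/-- The test function `f φ`, for smooth `f`. -/
noncomputable def mulTest (f : EuclideanSpace ℝ (Fin n) → ℝ) (hf : ContDiff ℝ ∞ f) (φ : 𝓓(Ω, ℝ)) :
    𝓓(Ω, ℝ) where
  toFun ξ := f ξ * φ ξ
  contDiff' := hf.mul φ.contDiff
  hasCompactSupport' := φ.hasCompactSupport.mul_left
  tsupport_subset' := (tsupport_mul_subset_right).trans φ.tsupport_subset

theorem gradient_mulTest {f : EuclideanSpace ℝ (Fin n) → ℝ} (hf : ContDiff ℝ ∞ f) (φ : 𝓓(Ω, ℝ))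
    {f' ξ : EuclideanSpace ℝ (Fin n)} (hf' : HasGradientAt f f' ξ) :
    ∇ (mulTest f hf φ) ξ = f ξ • ∇ φ ξ + φ ξ • f' := by
  have h : HasFDerivAt (mulTest f hf φ) _ ξ :=
    hf'.hasFDerivAt.mul (hasGradientAt_testFunction φ ξ).hasFDerivAt
  rw [h.hasGradientAt.gradient, map_add, map_smul, map_smul, LinearIsometryEquiv.symm_apply_apply,
    LinearIsometryEquiv.symm_apply_apply]

/-! ### Gaussian Hardy inequality in a half-space -/

/-- One-dimensional Gaussian Hardy inequality in a direction `v`: a test function supported in the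
half-space `{⟪v, ξ⟫ > 0}` satisfies `∫ φ² dm ≤ ∫ (∂ᵥφ)² dm`, since the positive function
`ξ ↦ ⟪v, ξ⟫` is an eigenfunction of the Gaussian Laplacian with eigenvalue `1`. -/
theorem integral_sq_le_integral_inner_gradient_sq (φ : 𝓓(Ω, ℝ)) {v : EuclideanSpace ℝ (Fin n)}
    (hv : ‖v‖ = 1) (hΩ : ∀ ξ ∈ Ω, 0 < inner ℝ v ξ) :
    ∫ ξ in Ω, φ ξ ^ 2 ∂(gaussian n) ≤ ∫ ξ in Ω, inner ℝ (∇ φ ξ) v ^ 2 ∂(gaussian n) := by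
  set F : EuclideanSpace ℝ (Fin n) → ℝ :=
    fun ξ => Real.exp (-(1 / 2) * ‖ξ‖ ^ 2) * (φ ξ ^ 2 / inner ℝ v ξ) with hF
  -- Off `Ω` the quotient may divide by zero, but `φ` vanishes nearby, so `F` is smooth everywhere.
  have hzero : ∀ ξ ∉ Ω, F =ᶠ[𝓝 ξ] 0 := fun ξ hξ => by
    filter_upwards [testFunction_eventuallyEq_zero φ hξ] with y hy
    simp [hF, hy]
  have hFc : ContDiff ℝ 1 F := by
    refine contDiff_iff_contDiffAt.2 fun ξ => ?_
    by_cases hξ : ξ ∈ Ω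
    · have hφ : ContDiff ℝ 1 φ := φ.contDiff.of_le (by simp)
      have h1 : ContDiff ℝ 1 fun ξ : EuclideanSpace ℝ (Fin n) =>
          Real.exp (-(1 / 2) * ‖ξ‖ ^ 2) := by
        have := contDiff_norm_sq ℝ (E := EuclideanSpace ℝ (Fin n)) (n := 1)
        fun_prop
      have h2 : ContDiff ℝ 1 fun ξ : EuclideanSpace ℝ (Fin n) => inner ℝ v ξ :=
        contDiff_const.inner ℝ contDiff_id
      exact h1.contDiffAt.mul ((hφ.pow 2).contDiffAt.div h2.contDiffAt (hΩ ξ hξ).ne')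
    · exact contDiffAt_const.congr_of_eventuallyEq (hzero ξ hξ)
  have hFs : HasCompactSupport F := by
    refine φ.hasCompactSupport.mono fun ξ hξ h => hξ ?_
    simp [hF, h]
  have hF0 : ∫ ξ, fderiv ℝ F ξ v = 0 := by
    have := integral_mul_fderiv_eq_neg_fderiv_mul_of_integrable (μ := volume) (v := v)
      (f := fun _ : EuclideanSpace ℝ (Fin n) => (1 : ℝ)) (g := F) (by simp)
      (by simpa using ((hFc.continuous_fderiv (by simp)).clm_apply
        continuous_const).integrable_of_hasCompactSupport (hFs.fderiv_apply ℝ v))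
      (by simpa using hFc.continuous.integrable_of_hasCompactSupport hFs)
      (fun x _ => by fun_prop) (fun x _ => (hFc.differentiable (by simp)) x)
    simpa using this
  -- With `p = ⟪v, ξ⟫` and density `G`, `∂ᵥ(G φ² / p) = G (2 φ ∂ᵥφ / p - φ² / p² - φ²)`, and
  -- completing the square bounds this by `G ((∂ᵥφ)² - φ²)`; the integral of the left side is `0`.
  have hle : ∀ ξ, fderiv ℝ F ξ v ≤
      Real.exp (-(1 / 2) * ‖ξ‖ ^ 2) * inner ℝ (∇ φ ξ) v ^ 2 -
        Real.exp (-(1 / 2) * ‖ξ‖ ^ 2) * φ ξ ^ 2 := by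
    intro ξ
    by_cases hξ : ξ ∈ Ω
    · have hp := hΩ ξ hξ
      have hφ := (hasGradientAt_testFunction φ ξ).hasFDerivAt
      have h1 : HasFDerivAt (fun ξ : EuclideanSpace ℝ (Fin n) => Real.exp (-(1 / 2) * ‖ξ‖ ^ 2))
          _ ξ := (((hasStrictFDerivAt_norm_sq ξ).hasFDerivAt).const_mul (-(1 / 2))).exp
      have h2 : HasFDerivAt (fun ξ : EuclideanSpace ℝ (Fin n) => inner ℝ v ξ) (innerSL ℝ v) ξ :=
        (innerSL ℝ v).hasFDerivAt
      have h3 := h1.mul ((hφ.pow 2).mul ((hasDerivAt_inv hp.ne').comp_hasFDerivAt ξ h2))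
      have h4 : fderiv ℝ F ξ v = Real.exp (-(1 / 2) * ‖ξ‖ ^ 2) *
          (2 * inner ℝ (∇ φ ξ) v * (φ ξ / inner ℝ v ξ) - (φ ξ / inner ℝ v ξ) ^ 2 - φ ξ ^ 2) := by
        rw [show fderiv ℝ F ξ = _ from h3.fderiv]
        simp [hv, real_inner_comm]
        field_simp
        ring
      rw [h4]
      nlinarith [mul_nonneg (Real.exp_pos (-(1 / 2) * ‖ξ‖ ^ 2)).le
        (sq_nonneg (inner ℝ (∇ φ ξ) v - φ ξ / inner ℝ v ξ))]
    · have h0 := (testFunction_eventuallyEq_zero φ hξ).self_of_nhds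
      rw [(hzero ξ hξ).fderiv_eq, h0]
      simp
      positivity
  have hint : ∀ {f : EuclideanSpace ℝ (Fin n) → ℝ}, Continuous f → HasCompactSupport f →
      Integrable f volume := fun hc hs => hc.integrable_of_hasCompactSupport hs
  have hi1 : Integrable (fun ξ => Real.exp (-(1 / 2) * ‖ξ‖ ^ 2) * inner ℝ (∇ φ ξ) v ^ 2)
      (volume : Measure (EuclideanSpace ℝ (Fin n))) := by
    have := continuous_gradient_testFunction φ
    refine hint (by fun_prop) ((hasCompactSupport_gradient_testFunction φ).mono fun ξ hξ h =>
      hξ ?_)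
    simp [h]
  have hi2 : Integrable (fun ξ => Real.exp (-(1 / 2) * ‖ξ‖ ^ 2) * φ ξ ^ 2)
      (volume : Measure (EuclideanSpace ℝ (Fin n))) :=
    hint (by fun_prop) (φ.hasCompactSupport.mono fun ξ hξ h => hξ (by simp [h]))
  rw [setIntegral_gaussian Ω.isOpen.measurableSet, setIntegral_gaussian Ω.isOpen.measurableSet,
    setIntegral_eq_integral_of_forall_compl_eq_zero fun ξ hξ => by
      simp [(testFunction_eventuallyEq_zero φ hξ).self_of_nhds],
    setIntegral_eq_integral_of_forall_compl_eq_zero fun ξ hξ => by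
      simp [(testFunction_eventuallyEq_zero φ hξ).gradient_eq]]
  have := integral_mono (hint ((hFc.continuous_fderiv (by simp)).clm_apply continuous_const)
    (hFs.fderiv_apply ℝ v)) (hi1.sub hi2) hle
  rw [hF0] at this
  simp only [Pi.sub_apply, integral_sub hi1 hi2] at this
  linarith

/-! ### Approximation by test functions in `V(Ω)` -/

/-- The test functions `φ k` converge to `w` in `V(Ω)`, with limit gradient `Dw`. -/
structure TendstoV (φ : ℕ → 𝓓(Ω, ℝ)) (w : EuclideanSpace ℝ (Fin n) → ℝ)
    (Dw : EuclideanSpace ℝ (Fin n) → EuclideanSpace ℝ (Fin n)) : Prop where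
  memLp : MemLp w 2 ((gaussian n).restrict Ω)
  memLp_grad : MemLp Dw 2 ((gaussian n).restrict Ω)
  tendsto : Tendsto (fun k => eLpNorm (⇑(φ k) - w) 2 ((gaussian n).restrict Ω)) atTop (𝓝 0)
  tendsto_grad :
    Tendsto (fun k => eLpNorm (∇ (φ k) - Dw) 2 ((gaussian n).restrict Ω)) atTop (𝓝 0)

theorem MemV₀.exists_tendstoV (h : MemV₀ Ω w) :
    ∃ (Dw : EuclideanSpace ℝ (Fin n) → EuclideanSpace ℝ (Fin n)) (φ : ℕ → 𝓓(Ω, ℝ)),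
      MemVWith Ω w Dw ∧ TendstoV φ w Dw ∧
      ∀ᵐ ξ ∂((gaussian n).restrict Ω), Tendsto (fun k => φ k ξ) atTop (𝓝 (w ξ)) := by
  obtain ⟨Dw, hw, h⟩ := h
  choose φ hφ using fun k : ℕ => h ((k : ENNReal) + 1)⁻¹ (by simp)
  have hlim : Tendsto (fun k : ℕ => ((k : ENNReal) + 1)⁻¹) atTop (𝓝 0) := by
    have := ENNReal.tendsto_inv_nat_nhds_zero.comp (tendsto_add_atTop_nat 1)
    simpa [Function.comp_def] using this
  have hsq : ∀ {a : ℕ → ENNReal}, (∀ k, a k ^ 2 ≤ ((k : ENNReal) + 1)⁻¹) →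
      Tendsto a atTop (𝓝 0) := fun {a} ha => by
    have h2 := (tendsto_of_tendsto_of_tendsto_of_le_of_le tendsto_const_nhds hlim
      (fun _ => zero_le) ha).ennrpow_const (1 / 2)
    refine (h2.congr fun k => ?_).trans (by simp)
    rw [← ENNReal.rpow_natCast, ← ENNReal.rpow_mul]
    simp
  have h1 : Tendsto (fun k => eLpNorm (⇑(φ k) - w) 2 ((gaussian n).restrict Ω)) atTop (𝓝 0) := by
    refine hsq fun k => ?_
    rw [eLpNorm_sub_comm]
    exact le_self_add.trans (hφ k).le
  have h2 : Tendsto (fun k => eLpNorm (∇ (φ k) - Dw) 2 ((gaussian n).restrict Ω)) atTop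
      (𝓝 0) := by
    refine hsq fun k => ?_
    rw [eLpNorm_sub_comm]
    exact le_add_self.trans (hφ k).le
  obtain ⟨ns, hns, hae⟩ := (tendstoInMeasure_of_tendsto_eLpNorm two_ne_zero
    (fun k => (φ k).continuous.aestronglyMeasurable) hw.memH.1 h1).exists_seq_tendsto_ae
  exact ⟨Dw, fun k => φ (ns k), hw, ⟨hw.memH, hw.memLp_grad, h1.comp hns.tendsto_atTop,
    h2.comp hns.tendsto_atTop⟩, hae⟩

/-- Chain rule: if `φ k → w` in `V(Ω)` and almost everywhere, then `T ∘ φ k → T ∘ w` in `V(Ω)`,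
the limit gradient being `T'(w) Dw`. -/
theorem TendstoV.compTest {φ : ℕ → 𝓓(Ω, ℝ)} (h : TendstoV φ w Dw)
    (hae : ∀ᵐ ξ ∂((gaussian n).restrict Ω), Tendsto (fun k => φ k ξ) atTop (𝓝 (w ξ)))
    {T : ℝ → ℝ} (hT : ContDiff ℝ ∞ T) (hT0 : T 0 = 0) (hT1 : ∀ t, |deriv T t| ≤ 1) :
    TendstoV (fun k => compTest T hT hT0 (φ k)) (fun ξ => T (w ξ))
      (fun ξ => deriv T (w ξ) • Dw ξ) := by
  have hlip : LipschitzWith 1 T :=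
    lipschitzWith_of_nnnorm_deriv_le (hT.differentiable (by simp)) fun t => by
      simpa [← NNReal.coe_le_coe] using hT1 t
  have hdc : Continuous (deriv T) := hT.continuous_deriv (by simp)
  have hd : ∀ {f : EuclideanSpace ℝ (Fin n) → ℝ},
      AEStronglyMeasurable f ((gaussian n).restrict Ω) →
      AEStronglyMeasurable (fun ξ => deriv T (f ξ)) ((gaussian n).restrict Ω) := fun hf =>
    hdc.comp_aestronglyMeasurable hf
  have hb : ∀ t (x : EuclideanSpace ℝ (Fin n)), ‖deriv T t • x‖ ≤ ‖x‖ := fun t x => by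
    rw [norm_smul]
    exact mul_le_of_le_one_left (norm_nonneg _) (hT1 t)
  refine ⟨hlip.comp_memLp hT0 h.memLp, h.memLp_grad.of_le
    ((hd h.memLp.1).smul h.memLp_grad.1) (ae_of_all _ fun ξ => hb _ _), ?_, ?_⟩
  · refine tendsto_of_tendsto_of_tendsto_of_le_of_le tendsto_const_nhds h.tendsto
      (fun _ => zero_le) fun k => eLpNorm_mono fun ξ => ?_
    simpa [dist_eq_norm] using! hlip.dist_le_mul (φ k ξ) (w ξ)
  · have hA : ∀ k, AEStronglyMeasurable (fun ξ => deriv T (φ k ξ) • (∇ (φ k) ξ - Dw ξ))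
        ((gaussian n).restrict Ω) := fun k =>
      (hd (φ k).continuous.aestronglyMeasurable).smul
        ((continuous_gradient_testFunction (φ k)).aestronglyMeasurable.sub h.memLp_grad.1)
    have hB : ∀ k, AEStronglyMeasurable (fun ξ => (deriv T (φ k ξ) - deriv T (w ξ)) • Dw ξ)
        ((gaussian n).restrict Ω) := fun k =>
      ((hd (φ k).continuous.aestronglyMeasurable).sub (hd h.memLp.1)).smul h.memLp_grad.1
    have hB0 : Tendsto (fun k => eLpNorm (fun ξ => (deriv T (φ k ξ) - deriv T (w ξ)) • Dw ξ) 2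
        ((gaussian n).restrict Ω)) atTop (𝓝 0) := by
      refine tendsto_eLpNorm_two_zero_of_dominated hB (h.memLp_grad.norm.const_mul 2)
        (fun k => ae_of_all _ fun ξ => ?_) ?_
      · rw [sub_smul]
        linarith [norm_sub_le (deriv T (φ k ξ) • Dw ξ) (deriv T (w ξ) • Dw ξ),
          hb (φ k ξ) (Dw ξ), hb (w ξ) (Dw ξ)]
      · filter_upwards [hae] with ξ hξ
        simpa using (((hdc.tendsto _).comp hξ).sub_const (deriv T (w ξ))).smul_const (Dw ξ)
    refine tendsto_of_tendsto_of_tendsto_of_le_of_le tendsto_const_nhds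
      (by simpa using h.tendsto_grad.add hB0) (fun _ => zero_le) fun k => ?_
    -- `T'(φₖ) Dφₖ - T'(w) Dw = T'(φₖ) (Dφₖ - Dw) + (T'(φₖ) - T'(w)) Dw`; the last term tends to
    -- zero by dominated convergence.
    have heq : ∇ (GaussianSobolev.compTest T hT hT0 (φ k)) - (fun ξ => deriv T (w ξ) • Dw ξ) =
        (fun ξ => deriv T (φ k ξ) • (∇ (φ k) ξ - Dw ξ)) +
          fun ξ => (deriv T (φ k ξ) - deriv T (w ξ)) • Dw ξ := by
      ext1 ξ
      simp only [Pi.sub_apply, Pi.add_apply, gradient_compTest, smul_sub, sub_smul]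
      abel
    rw [heq]
    exact (eLpNorm_add_le (hA k) (hB k) (by simp)).trans
      (add_le_add_left (eLpNorm_mono fun ξ => hb _ _) _)

/-! ### Locality of the weak gradient -/

/-- The weak gradient tested with `exp (-|ξ|² / 2) φ`: integration by parts with respect to `dm`,
where both sides involve only functions square integrable for `dm`. -/
theorem MemVWith.setIntegral_gaussian_eq (h : MemVWith Ω u Du) (i : Fin n) (φ : 𝓓(Ω, ℝ)) :
    ∫ ξ in Ω, u ξ * ((∇ φ ξ) i - ξ i * φ ξ) ∂(gaussian n) =
      -∫ ξ in Ω, (Du ξ) i * φ ξ ∂(gaussian n) := by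
  have hG : ContDiff ℝ ∞ fun ξ : EuclideanSpace ℝ (Fin n) => Real.exp (-(1 / 2) * ‖ξ‖ ^ 2) := by
    have := contDiff_norm_sq ℝ (E := EuclideanSpace ℝ (Fin n)) (n := ∞)
    fun_prop
  have hG' : ∀ ξ : EuclideanSpace ℝ (Fin n),
      HasGradientAt (fun ξ : EuclideanSpace ℝ (Fin n) => Real.exp (-(1 / 2) * ‖ξ‖ ^ 2))
        (-Real.exp (-(1 / 2) * ‖ξ‖ ^ 2) • ξ) ξ := fun ξ => by
    rw [hasGradientAt_iff_hasFDerivAt]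
    refine (((hasStrictFDerivAt_norm_sq ξ).hasFDerivAt).const_mul (-(1 / 2))).exp.congr_fderiv ?_
    ext y
    simp
  have := h.isWeakGradient.integral_eq i (mulTest _ hG φ)
  rw [setIntegral_gaussian Ω.isOpen.measurableSet, setIntegral_gaussian Ω.isOpen.measurableSet]
  convert this using 3 with ξ
  · rw [gradient_mulTest hG φ (hG' ξ)]
    simp
    ring
  · ext ξ
    change _ = Du ξ i * (Real.exp (-(1 / 2) * ‖ξ‖ ^ 2) * φ ξ)
    ring

/-- Locality of the weak gradient: `Dw = Du` almost everywhere on `{χ ≠ 0}` for every `V`-limit `χ`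
of test functions which vanishes, together with its gradient, off `{w = u}`. No chain rule for `w`
or `u` themselves is needed, since all derivatives in `∫ (w - u) ∂ᵢ(η ψₖ) dm` fall on test
functions. -/
theorem smul_grad_ae_eq_smul_grad (hu : MemVWith Ω u Du) (hw : MemVWith Ω w Dw)
    {ψ : ℕ → 𝓓(Ω, ℝ)} {χ : EuclideanSpace ℝ (Fin n) → ℝ}
    {Dχ : EuclideanSpace ℝ (Fin n) → EuclideanSpace ℝ (Fin n)} (hψ : TendstoV ψ χ Dχ)
    (hχ : ∀ ξ, w ξ ≠ u ξ → χ ξ = 0 ∧ Dχ ξ = 0) :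
    ∀ᵐ ξ ∂((gaussian n).restrict Ω), χ ξ • Dw ξ = χ ξ • Du ξ := by
  set μ := (gaussian n).restrict (Ω : Set (EuclideanSpace ℝ (Fin n))) with hμ
  have hz : MemLp (fun ξ => w ξ - u ξ) 2 μ := hw.memH.sub hu.memH
  have hcomp : ∀ {f : EuclideanSpace ℝ (Fin n) → EuclideanSpace ℝ (Fin n)} (i : Fin n),
      MemLp f 2 μ → MemLp (fun ξ => f ξ i) 2 μ := fun {f} i hf =>
    hf.of_le ((EuclideanSpace.proj (𝕜 := ℝ) i).continuous.comp_aestronglyMeasurable hf.1)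
      (ae_of_all _ fun ξ => PiLp.norm_apply_le _ _)
  have hDz : ∀ i, MemLp (fun ξ => Dw ξ i - Du ξ i) 2 μ := fun i =>
    (hcomp i hw.memLp_grad).sub (hcomp i hu.memLp_grad)
  have hIBP : ∀ (i : Fin n) (φ : 𝓓(Ω, ℝ)),
      ∫ ξ, (w ξ - u ξ) * ((∇ φ ξ) i - ξ i * φ ξ) ∂μ = -∫ ξ, (Dw ξ i - Du ξ i) * φ ξ ∂μ := by
    intro i φ
    have hφ := memLp_testFunction φ
    have hb : MemLp (fun ξ => (∇ φ ξ) i - ξ i * φ ξ) 2 μ := by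
      have := continuous_gradient_testFunction φ
      refine (hcomp i (memLp_gradient_testFunction φ)).sub
        (Continuous.memLp_of_hasCompactSupport (by fun_prop) φ.hasCompactSupport.mul_left)
    have hi : ∀ {f g : EuclideanSpace ℝ (Fin n) → ℝ}, MemLp f 2 μ → MemLp g 2 μ →
        Integrable (fun ξ => f ξ * g ξ) μ := fun hf hg => hf.integrable_mul hg
    simp_rw [sub_mul (w _), sub_mul ((Dw _).ofLp i)]
    rw [integral_sub (hi hw.memH hb) (hi hu.memH hb),
      integral_sub (hi (hcomp i hw.memLp_grad) hφ) (hi (hcomp i hu.memLp_grad) hφ),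
      hw.setIntegral_gaussian_eq, hu.setIntegral_gaussian_eq]
    ring
  -- Insert the test function `η ψₖ` and let `k → ∞`: the limit of the left side vanishes.
  have hzero : ∀ (i : Fin n) (η : 𝓓(Ω, ℝ)), ∫ ξ, η ξ * ((Dw ξ i - Du ξ i) * χ ξ) ∂μ = 0 := by
    intro i η
    have hη : MemLp η ⊤ μ := η.continuous.memLp_of_hasCompactSupport η.hasCompactSupport
    have hη' := continuous_gradient_testFunction η
    have hb : MemLp (fun ξ => (∇ η ξ) i - ξ i * η ξ) ⊤ μ := by
      refine Continuous.memLp_of_hasCompactSupport (by fun_prop)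
        (((hasCompactSupport_gradient_testFunction η).comp_left
          (g := fun x : EuclideanSpace ℝ (Fin n) => x i) rfl).sub η.hasCompactSupport.mul_left)
    have hψi : Tendsto (fun k => eLpNorm ((fun ξ => (∇ (ψ k) ξ) i) - fun ξ => Dχ ξ i) 2 μ) atTop
        (𝓝 0) :=
      tendsto_of_tendsto_of_tendsto_of_le_of_le tendsto_const_nhds hψ.tendsto_grad
        (fun _ => zero_le) fun k => eLpNorm_mono fun ξ => PiLp.norm_apply_le
          (∇ (ψ k) ξ - Dχ ξ) i
    have hzη : MemLp (fun ξ => η ξ * (w ξ - u ξ)) 2 μ := hz.mul hη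
    have hzb : MemLp (fun ξ => ((∇ η ξ) i - ξ i * η ξ) * (w ξ - u ξ)) 2 μ := hz.mul hb
    have hDzη : MemLp (fun ξ => η ξ * (Dw ξ i - Du ξ i)) 2 μ := (hDz i).mul hη
    have L1 := tendsto_integral_inner_const hzη
      (fun k => hcomp i (memLp_gradient_testFunction (ψ k))) (hcomp i hψ.memLp_grad) hψi
    have L2 := tendsto_integral_inner_const hzb (fun k => memLp_testFunction (ψ k)) hψ.memLp
      hψ.tendsto
    have L3 := tendsto_integral_inner_const hDzη (fun k => memLp_testFunction (ψ k)) hψ.memLp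
      hψ.tendsto
    have hlim := L1.add L2
    have e1 : ∫ ξ, inner ℝ (η ξ * (w ξ - u ξ)) (Dχ ξ i) ∂μ = 0 := by
      refine integral_eq_zero_of_ae (ae_of_all _ fun ξ => ?_)
      by_cases h : w ξ = u ξ
      · simp [h]
      · simp [(hχ ξ h).2]
    have e2 : ∫ ξ, inner ℝ (((∇ η ξ) i - ξ i * η ξ) * (w ξ - u ξ)) (χ ξ) ∂μ = 0 := by
      refine integral_eq_zero_of_ae (ae_of_all _ fun ξ => ?_)
      by_cases h : w ξ = u ξ
      · simp [h]
      · simp [(hχ ξ h).1]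
    rw [e1, e2, add_zero] at hlim
    have hk : ∀ k, ∫ ξ, inner ℝ (η ξ * (w ξ - u ξ)) ((∇ (ψ k) ξ) i) ∂μ +
        ∫ ξ, inner ℝ (((∇ η ξ) i - ξ i * η ξ) * (w ξ - u ξ)) (ψ k ξ) ∂μ =
        -∫ ξ, inner ℝ (η ξ * (Dw ξ i - Du ξ i)) (ψ k ξ) ∂μ := by
      intro k
      rw [← integral_add (integrable_inner_of_memLp hzη
        (hcomp i (memLp_gradient_testFunction (ψ k))))
        (integrable_inner_of_memLp hzb (memLp_testFunction (ψ k)))]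
      convert hIBP i (mulTest η η.contDiff (ψ k)) using 3 with ξ
      · rw [gradient_mulTest η.contDiff (ψ k) (hasGradientAt_testFunction η ξ)]
        change _ = _ * (_ - ξ i * (η ξ * ψ k ξ))
        simp
        ring
      · ext ξ
        change _ = _ * (η ξ * ψ k ξ)
        simp
        ring
    have := tendsto_nhds_unique (hlim.congr hk) L3.neg
    rw [zero_eq_neg] at this
    rw [← this]
    refine integral_congr_ae (ae_of_all _ fun ξ => ?_)
    simp
    ring
  have hae : ∀ i : Fin n, ∀ᵐ ξ ∂(gaussian n), ξ ∈ (Ω : Set (EuclideanSpace ℝ (Fin n))) →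
      (Dw ξ i - Du ξ i) * χ ξ = 0 := fun i => by
    refine Ω.isOpen.ae_eq_zero_of_integral_contDiff_smul_eq_zero
      (IntegrableOn.locallyIntegrableOn ((hDz i).integrable_mul hψ.memLp)) fun g hg hgs hgt => ?_
    rw [← hzero i ⟨g, hg, hgs, hgt⟩, hμ, eq_comm]
    refine setIntegral_eq_integral_of_forall_compl_eq_zero fun ξ hξ => ?_
    change g ξ * _ = 0
    rw [image_eq_zero_of_notMem_tsupport fun h => hξ (hgt h), zero_mul]
  rw [hμ, ae_restrict_iff' Ω.isOpen.measurableSet]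
  filter_upwards [ae_all_iff.2 hae] with ξ hξ hΩ
  ext i
  have := hξ i hΩ
  simp only [PiLp.smul_apply, smul_eq_mul]
  linarith

/-! ### A smooth approximation of the absolute value -/

/-- The smooth approximation `√(t² + ε²) - ε` of `|t|`; it vanishes to second order at `0`. -/
noncomputable def smoothAbs (ε t : ℝ) : ℝ := √(t ^ 2 + ε ^ 2) - ε

theorem contDiff_smoothAbs {ε : ℝ} (hε : 0 < ε) : ContDiff ℝ ∞ (smoothAbs ε) :=
  (ContDiff.sqrt (by fun_prop) fun t => by positivity).sub contDiff_const

theorem smoothAbs_zero {ε : ℝ} (hε : 0 < ε) : smoothAbs ε 0 = 0 := by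
  simp [smoothAbs, Real.sqrt_sq hε.le]

theorem smoothAbs_nonneg (ε t : ℝ) : 0 ≤ smoothAbs ε t :=
  sub_nonneg.2 (Real.le_sqrt_of_sq_le (by nlinarith [sq_nonneg t]))

theorem smoothAbs_pos {ε t : ℝ} (hε : 0 < ε) (ht : t ≠ 0) : 0 < smoothAbs ε t :=
  sub_pos.2 ((Real.lt_sqrt hε.le).2 (by have := sq_pos_of_ne_zero ht; linarith))

theorem smoothAbs_le {ε : ℝ} (hε : 0 < ε) (t : ℝ) : smoothAbs ε t ≤ |t| := by
  rw [smoothAbs, sub_le_iff_le_add]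
  refine Real.sqrt_le_iff.2 ⟨by positivity, ?_⟩
  nlinarith [sq_abs t, mul_nonneg (abs_nonneg t) hε.le]

theorem deriv_smoothAbs {ε : ℝ} (hε : 0 < ε) (t : ℝ) :
    deriv (smoothAbs ε) t = t / √(t ^ 2 + ε ^ 2) := by
  have h : HasDerivAt (smoothAbs ε) _ t :=
    (((hasDerivAt_pow 2 t).add_const (ε ^ 2)).sqrt (by positivity)).sub_const ε
  rw [h.deriv]
  simp
  ring

theorem abs_deriv_smoothAbs_le {ε : ℝ} (hε : 0 < ε) (t : ℝ) : |deriv (smoothAbs ε) t| ≤ 1 := by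
  rw [deriv_smoothAbs hε, abs_div, abs_of_pos (by positivity : 0 < √(t ^ 2 + ε ^ 2))]
  exact div_le_one_of_le₀ (Real.abs_le_sqrt (by nlinarith)) (by positivity)

theorem tendsto_smoothAbs (t : ℝ) :
    Tendsto (fun k : ℕ => smoothAbs (1 / ((k : ℝ) + 1)) t) atTop (𝓝 |t|) := by
  have h : Continuous fun ε => smoothAbs ε t := by unfold smoothAbs; fun_prop
  simpa [smoothAbs, Real.sqrt_sq_eq_abs, Function.comp_def] using
    (h.tendsto 0).comp tendsto_one_div_add_atTop_nhds_zero_nat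

/-! ### Weak maximum principle -/

/-- Weak maximum principle for `Δ - ξ · D + 1` in an open set whose first Dirichlet eigenvalue for
the Gaussian Laplacian is at least `c > 1`. -/
theorem IsWeakSubsolution.ae_nonpos (hu : IsWeakSubsolution Ω u)
    (hbdry : MemV₀ Ω fun ξ => max (u ξ) 0)
    {c : ℝ} (hc : 1 < c) (hP : ∀ φ : 𝓓(Ω, ℝ), c * ∫ ξ in Ω, φ ξ ^ 2 ∂(gaussian n) ≤
      ∫ ξ in Ω, ‖∇ φ ξ‖ ^ 2 ∂(gaussian n)) :
    ∀ᵐ ξ ∂((gaussian n).restrict Ω), u ξ ≤ 0 := by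
  obtain ⟨Du, hDu, hsub⟩ := hu
  obtain ⟨Dw, φ, hDw, hφ, hae⟩ := hbdry.exists_tendstoV
  set w : EuclideanSpace ℝ (Fin n) → ℝ := fun ξ => max (u ξ) 0
  have hw0 : ∀ ξ, 0 ≤ w ξ := fun ξ => le_max_right _ _
  have hwL : MemLp w 2 ((gaussian n).restrict Ω) := hDw.memH
  have hTL : ∀ {ε : ℝ}, 0 < ε →
      MemLp (fun ξ => smoothAbs ε (w ξ)) 2 ((gaussian n).restrict Ω) := fun hε =>
    (hφ.compTest hae (contDiff_smoothAbs hε) (smoothAbs_zero hε) (abs_deriv_smoothAbs_le hε)).memLp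
  have key : ∀ ε > 0, c * ∫ ξ in Ω, smoothAbs ε (w ξ) ^ 2 ∂(gaussian n) ≤
      ∫ ξ in Ω, w ξ * smoothAbs ε (w ξ) ∂(gaussian n) := by
    intro ε hε
    have hψ := hφ.compTest hae (contDiff_smoothAbs hε) (smoothAbs_zero hε)
      (abs_deriv_smoothAbs_le hε)
    set ψ := fun k => compTest (smoothAbs ε) (contDiff_smoothAbs hε) (smoothAbs_zero hε) (φ k)
    -- `w ≠ u` only where `w = 0`, and there `T` and `T'` vanish.
    have hgrad := smul_grad_ae_eq_smul_grad hDu hDw hψ fun ξ hξ => by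
      have h0 : w ξ = 0 := max_eq_right (le_of_not_ge fun h => hξ (max_eq_left h))
      simp [h0, smoothAbs_zero hε, deriv_smoothAbs hε]
    have h1 : c * ∫ ξ in Ω, smoothAbs ε (w ξ) ^ 2 ∂(gaussian n) ≤
        ∫ ξ in Ω, ‖deriv (smoothAbs ε) (w ξ) • Dw ξ‖ ^ 2 ∂(gaussian n) := by
      have a := (tendsto_integral_inner (fun k => memLp_testFunction (ψ k))
        (fun k => memLp_testFunction (ψ k)) hψ.memLp hψ.memLp hψ.tendsto hψ.tendsto).const_mul c
      have b := tendsto_integral_inner (fun k => memLp_gradient_testFunction (ψ k))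
        (fun k => memLp_gradient_testFunction (ψ k)) hψ.memLp_grad hψ.memLp_grad
        hψ.tendsto_grad hψ.tendsto_grad
      simp only [real_inner_self_eq_norm_sq] at a b
      simpa using le_of_tendsto_of_tendsto' a b fun k => by simpa using hP (ψ k)
    have hi1 := integrable_inner_of_memLp hDu.memLp_grad hψ.memLp_grad
    have h2 : ∫ ξ in Ω, inner ℝ (Du ξ) (deriv (smoothAbs ε) (w ξ) • Dw ξ) ∂(gaussian n) ≤
        ∫ ξ in Ω, inner ℝ (u ξ) (smoothAbs ε (w ξ)) ∂(gaussian n) := by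
      refine le_of_tendsto_of_tendsto' (tendsto_integral_inner_const hDu.memLp_grad
        (fun k => memLp_gradient_testFunction (ψ k)) hψ.memLp_grad hψ.tendsto_grad)
        (tendsto_integral_inner_const hDu.memH (fun k => memLp_testFunction (ψ k)) hψ.memLp
          hψ.tendsto) fun k => ?_
      rw [← sub_nonpos, ← integral_sub (integrable_inner_of_memLp hDu.memLp_grad
        (memLp_gradient_testFunction (ψ k))) (integrable_inner_of_memLp hDu.memH
        (memLp_testFunction (ψ k)))]
      simpa [mul_comm] using hsub (ψ k) fun ξ => smoothAbs_nonneg _ _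
    have h3 : ∫ ξ in Ω, ‖deriv (smoothAbs ε) (w ξ) • Dw ξ‖ ^ 2 ∂(gaussian n) ≤
        ∫ ξ in Ω, inner ℝ (Du ξ) (deriv (smoothAbs ε) (w ξ) • Dw ξ) ∂(gaussian n) := by
      refine integral_mono_ae ((memLp_two_iff_integrable_sq_norm hψ.memLp_grad.1).1
        hψ.memLp_grad) hi1 ?_
      filter_upwards [hgrad] with ξ hξ
      -- Pointwise `T'(w)² |Dw|² ≤ T'(w) |Dw|²` because `0 ≤ T' ≤ 1` on `[0, ∞)`.
      by_cases h0 : w ξ = 0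
      · simp [h0, deriv_smoothAbs hε]
      · rw [← smul_right_injective _ (smoothAbs_pos hε h0).ne' hξ, norm_smul, mul_pow,
          real_inner_smul_right, real_inner_self_eq_norm_sq]
        have hd := abs_deriv_smoothAbs_le hε (w ξ)
        have hd0 : 0 ≤ deriv (smoothAbs ε) (w ξ) := by
          rw [deriv_smoothAbs hε]
          exact div_nonneg (hw0 ξ) (Real.sqrt_nonneg _)
        rw [abs_of_nonneg hd0] at hd
        rw [Real.norm_of_nonneg hd0]
        gcongr
        nlinarith
    have h4 : ∫ ξ in Ω, inner ℝ (u ξ) (smoothAbs ε (w ξ)) ∂(gaussian n) =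
        ∫ ξ in Ω, w ξ * smoothAbs ε (w ξ) ∂(gaussian n) := by
      refine integral_congr_ae (ae_of_all _ fun ξ => ?_)
      rcases le_total (u ξ) 0 with h | h
      · have h0 : w ξ = 0 := max_eq_right h
        simp [h0, smoothAbs_zero hε]
      · have h0 : w ξ = u ξ := max_eq_left h
        simp [h0, mul_comm]
    linarith
  have hwsq : Integrable (fun ξ => w ξ ^ 2) ((gaussian n).restrict Ω) := hwL.integrable_sq
  have hT : ∀ k : ℕ, (0 : ℝ) < 1 / ((k : ℝ) + 1) := fun k => by positivity
  have hb : ∀ (k : ℕ) ξ, smoothAbs (1 / ((k : ℝ) + 1)) (w ξ) ≤ w ξ := fun k ξ =>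
    (smoothAbs_le (hT k) _).trans (abs_of_nonneg (hw0 ξ)).le
  have hl : ∀ ξ, Tendsto (fun k : ℕ => smoothAbs (1 / ((k : ℝ) + 1)) (w ξ)) atTop (𝓝 (w ξ)) :=
    fun ξ => by simpa [abs_of_nonneg (hw0 ξ)] using tendsto_smoothAbs (w ξ)
  have lim1 : Tendsto (fun k : ℕ => ∫ ξ in Ω, smoothAbs (1 / ((k : ℝ) + 1)) (w ξ) ^ 2
      ∂(gaussian n)) atTop (𝓝 (∫ ξ in Ω, w ξ ^ 2 ∂(gaussian n))) := by
    refine tendsto_integral_of_dominated_convergence (fun ξ => w ξ ^ 2)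
      (fun k => (hTL (hT k)).1.pow 2) hwsq (fun k => ae_of_all _ fun ξ => ?_)
      (ae_of_all _ fun ξ => (hl ξ).pow 2)
    rw [norm_pow, Real.norm_of_nonneg (smoothAbs_nonneg _ _)]
    exact pow_le_pow_left₀ (smoothAbs_nonneg _ _) (hb k ξ) 2
  have lim2 : Tendsto (fun k : ℕ => ∫ ξ in Ω, w ξ * smoothAbs (1 / ((k : ℝ) + 1)) (w ξ)
      ∂(gaussian n)) atTop (𝓝 (∫ ξ in Ω, w ξ ^ 2 ∂(gaussian n))) := by
    refine tendsto_integral_of_dominated_convergence (fun ξ => w ξ ^ 2)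
      (fun k => hwL.1.mul (hTL (hT k)).1) hwsq (fun k => ae_of_all _ fun ξ => ?_)
      (ae_of_all _ fun ξ => ?_)
    · rw [Real.norm_of_nonneg (mul_nonneg (hw0 ξ) (smoothAbs_nonneg _ _)), sq]
      exact mul_le_mul_of_nonneg_left (hb k ξ) (hw0 ξ)
    · rw [sq]
      exact (hl ξ).const_mul _
  have hle := le_of_tendsto_of_tendsto' (lim1.const_mul c) lim2 fun k => key _ (hT k)
  have h0 : ∫ ξ in Ω, w ξ ^ 2 ∂(gaussian n) = 0 := by
    have : 0 ≤ ∫ ξ in Ω, w ξ ^ 2 ∂(gaussian n) := integral_nonneg fun ξ => sq_nonneg _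
    nlinarith
  filter_upwards [(integral_eq_zero_iff_of_nonneg (fun ξ => sq_nonneg _) hwsq).1 h0] with ξ hξ
  have : w ξ = 0 := by simpa using hξ
  exact max_eq_right_iff.1 this

/-! ### Spectral gap in the sector -/

/-- The sector is contained in the quarter plane `{|ξ₁| < ξ₀}`, as `π / N < π / 4`. -/
theorem abs_lt_of_mem_sector {N : ℕ} (hN : 5 ≤ N) {R : ℝ} (hR : 0 ≤ R)
    {ξ : EuclideanSpace ℝ (Fin 2)}
    (hξ : ξ ∈ sector R N) : |ξ 1| < ξ 0 := by
  obtain ⟨r, θ, hr, h1, h2, rfl⟩ := hξ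
  have hr0 : 0 < r := hR.trans_lt hr
  have hθ : |θ| < Real.pi / 4 := by
    refine (abs_lt.2 ⟨h1, h2⟩).trans_le ?_
    gcongr
    exact_mod_cast (by omega : 4 ≤ N)
  have hpi := Real.pi_pos
  have hs := Real.sin_lt_sin_of_lt_of_le_pi_div_two (by linarith [abs_nonneg θ])
    (by linarith) hθ
  have hc := Real.cos_lt_cos_of_nonneg_of_le_pi (abs_nonneg θ) (by linarith) hθ
  rw [Real.cos_abs, Real.cos_pi_div_four, ← Real.sin_pi_div_four] at hc
  have hsin : |Real.sin θ| = Real.sin |θ| :=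
    Real.abs_sin_eq_sin_abs_of_abs_le_pi (by linarith)
  simp only [Matrix.cons_val_zero, Matrix.cons_val_one, abs_mul, abs_of_pos hr0]
  rw [hsin]
  exact mul_lt_mul_of_pos_left (hs.trans hc) hr0

/-- Spectral gap `2` in the quarter plane `{|ξ₁| < ξ₀}`, from the half-space inequality in the
orthonormal directions `(1, ±1) / √2`. -/
theorem two_mul_integral_sq_le {Ω : Opens (EuclideanSpace ℝ (Fin 2))}
    (hΩ : ∀ ξ ∈ Ω, |ξ 1| < ξ 0) (φ : 𝓓(Ω, ℝ)) :
    2 * ∫ ξ in Ω, φ ξ ^ 2 ∂(gaussian 2) ≤ ∫ ξ in Ω, ‖∇ φ ξ‖ ^ 2 ∂(gaussian 2) := by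
  have hc : 0 < (√2)⁻¹ := by positivity
  have hc2 : ((√2)⁻¹ : ℝ) ^ 2 = 1 / 2 := by rw [inv_pow, Real.sq_sqrt (by norm_num)]; norm_num
  set c : ℝ := (√2)⁻¹
  have h1 := integral_sq_le_integral_inner_gradient_sq φ (v := !₂[c, c])
    (by rw [EuclideanSpace.norm_eq]; norm_num [Fin.sum_univ_two, hc2])
    (fun ξ hξ => by
      have := (abs_lt.1 (hΩ ξ hξ)).1
      simp [PiLp.inner_apply, Fin.sum_univ_two]
      nlinarith)
  have h2 := integral_sq_le_integral_inner_gradient_sq φ (v := !₂[c, -c])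
    (by rw [EuclideanSpace.norm_eq]; norm_num [Fin.sum_univ_two, hc2])
    (fun ξ hξ => by
      have := (abs_lt.1 (hΩ ξ hξ)).2
      simp [PiLp.inner_apply, Fin.sum_univ_two]
      nlinarith)
  have hi : ∀ v : EuclideanSpace ℝ (Fin 2),
      Integrable (fun ξ => inner ℝ (∇ φ ξ) v ^ 2) ((gaussian 2).restrict Ω) := fun v =>
    ((memLp_gradient_testFunction φ).inner_const v).integrable_sq
  rw [two_mul]
  refine (add_le_add h1 h2).trans_eq ?_
  rw [← integral_add (hi _) (hi _)]
  refine integral_congr_ae (ae_of_all _ fun ξ => ?_)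
  simp only [EuclideanSpace.norm_sq_eq, PiLp.inner_apply, Fin.sum_univ_two]
  simp
  linear_combination (2 * (∇ φ ξ) 0 ^ 2 + 2 * (∇ φ ξ) 1 ^ 2) * hc2

end GaussianSobolev

theorem mainTheorem5 (N : ℕ) (hN : 5 ≤ N) (R : ℝ) (hR : 0 ≤ R)
    (Ω' : Opens (EuclideanSpace ℝ (Fin 2)))
    (hΩ' : (Ω' : Set (EuclideanSpace ℝ (Fin 2))) ⊆ GaussianSobolev.sector R N)
    (u : EuclideanSpace ℝ (Fin 2) → ℝ)
    (hu : GaussianSobolev.MemV Ω' u)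
    (hLu : GaussianSobolev.IsWeakSubsolution Ω' u)
    (hbdry : GaussianSobolev.MemV₀ Ω' (fun ξ => max (u ξ) 0)) :
    ∀ᵐ ξ ∂(volume.restrict (Ω' : Set (EuclideanSpace ℝ (Fin 2)))), u ξ ≤ 0 :=
  (GaussianSobolev.volume_absolutelyContinuous_gaussian.restrict _).ae_le
    (hLu.ae_nonpos hbdry one_lt_two (GaussianSobolev.two_mul_integral_sq_le fun _ hξ =>
      GaussianSobolev.abs_lt_of_mem_sector hN hR (hΩ' hξ)))
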